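/- Let $N\ge 1$, let $\Omega\subset\mathbb R^N$ be a bounded open set (in particular, any bounded domain with Lipschitz boundary), let $0<\gamma<1<p<r<p^*$, where $p^*=\frac{Np}{N-p}$ if $p<N$ and $p^*=+\infty$ if $N\le p$, and let $\xi,a\in L^\infty(\Omega)$ with $0<\xi_0\le\operatorname{ess\,inf}_\Omega\xi$ and $a(x)>0$ for a.a. $x\in\Omega$. For $\lambda>0$ and $u\in W_0^{1,p}(\Omega)$ put $$\varphi_\lambda(u)=\frac1p\int_\Omega\xi|\nabla u|^p\,dx-\frac1{1-\gamma}\int_\Omega a|u|^{1-\gamma}\,dx-\frac\lambda r\int_\Omega|u|^r\,dx,$$ $$N_\lambda=\Big\{u\in W_0^{1,p}(\Omega): u\ne0,\ \int_\Omega\xi|\nabla u|^p\,dx=\int_\Omega a|u|^{1-\gamma}\,dx+\lambda\int_\Omega|u|^r\,dx\Big\},$$ $$N_\lambda^+=\Big\{u\in N_\lambda:(p+\gamma-1)\int_\Omega\xi|\nabla u|^p\,dx-\lambda(r+\gamma-1)\int_\Omega|u|^r\,dx>0\Big\}.$$ Let $\lambda>0$ and let $u^*\in N_\lambda^+$ be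 a minimizer of $\varphi_\lambda$ on $N_\lambda^+$, that is, $\varphi_\lambda(u^*)=\inf_{N_\lambda^+}\varphi_\lambda$, with $u^*\ge0$ a.e. in $\Omega$. Then $u^*$ is a weak solution of $$-\operatorname{div}(\xi|\nabla u|^{p-2}\nabla u)=a\,u^{-\gamma}+\lambda u^{r-1}\ \text{ in }\Omega,\qquad u|_{\partial\Omega}=0,$$ that is: $u^*>0$ a.e. in $\Omega$ and, for every $h\in W_0^{1,p}(\Omega)$, the functions $\xi|\nabla u^*|^{p-2}\nabla u^*\cdot\nabla h$, $a(u^*)^{-\gamma}h$ and $(u^*)^{r-1}h$ are integrable on $\Omega$ and $$\int_\Omega\xi|\nabla u^*|^{p-2}\nabla u^*\cdot\nabla h\,dx=\int_\Omega a(u^*)^{-\gamma}h\,dx+\lambda\int_\Omega(u^*)^{r-1}h\,dx.$$ In other words, $N_\lambda^+$ is a natural constraint for $\varphi_\lambda$, even though $\varphi_\lambda$ is not $C^1$. -/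

import Mathlib

open MeasureTheory Filter Topology
open scoped ContDiff Gradient

noncomputable section

namespace SingularPLaplace

/-- Euclidean space of dimension `N`. -/
abbrev E (N : ℕ) : Type := EuclideanSpace ℝ (Fin N)

/-- The critical Sobolev exponent: `N p / (N - p)` if `p < N`, and `∞` if `N ≤ p`. -/
def criticalExponent (N : ℕ) (p : ℝ) : ENNReal :=
  if p < (N : ℝ) then ENNReal.ofReal ((N : ℝ) * p / ((N : ℝ) - p)) else ⊤

/-- Smooth functions with compact support contained in `Ω`. -/
def IsTestFunction {N : ℕ} (Ω : Set (E N)) (φ : E N → ℝ) : Prop :=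
  ContDiff ℝ ∞ φ ∧ HasCompactSupport φ ∧ tsupport φ ⊆ Ω

/-- `g` is a weak (distributional) gradient of `u` on `Ω`. Only used for `u` and `g` that are
Lebesgue integrable to a power at least one on `Ω`, so that both integrals exist. -/
def HasWeakGradient {N : ℕ} (Ω : Set (E N)) (u : E N → ℝ) (g : E N → E N) : Prop :=
  ∀ φ : E N → ℝ, IsTestFunction Ω φ →
    ∫ x in Ω, u x • gradient φ x = - ∫ x in Ω, φ x • g x

/-- Representatives of elements of the Sobolev space `W₀^{1,p}(Ω)`, that is, of the closure of
the test functions in `W^{1,p}(Ω)`; a function is given together with (a representative of) its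
weak gradient, which is unique up to null sets. Values outside `Ω` are irrelevant. -/
structure W0 {N : ℕ} (Ω : Set (E N)) (p : ℝ) where
  /-- the function -/
  toFun : E N → ℝ
  /-- its weak gradient -/
  grad : E N → E N
  memLp : MemLp toFun (ENNReal.ofReal p) (volume.restrict Ω)
  memLp_grad : MemLp grad (ENNReal.ofReal p) (volume.restrict Ω)
  hasWeakGradient : HasWeakGradient Ω toFun grad
  exists_approx : ∃ φ : ℕ → E N → ℝ, (∀ n, IsTestFunction Ω (φ n)) ∧
    Tendsto (fun n => eLpNorm (fun x => φ n x - toFun x) (ENNReal.ofReal p)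
      (volume.restrict Ω)) atTop (𝓝 0) ∧
    Tendsto (fun n => eLpNorm (fun x => gradient (φ n) x - grad x) (ENNReal.ofReal p)
      (volume.restrict Ω)) atTop (𝓝 0)

variable {N : ℕ} {Ω : Set (E N)} {p : ℝ}

/-- `∫_Ω ξ |∇u|^p dx`. -/
def gradTerm (ξ : E N → ℝ) (u : W0 Ω p) : ℝ :=
  ∫ x in Ω, ξ x * ‖u.grad x‖ ^ p

/-- `∫_Ω a |u|^{1-γ} dx`. -/
def singularTerm (a : E N → ℝ) (γ : ℝ) (u : W0 Ω p) : ℝ :=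
  ∫ x in Ω, a x * |u.toFun x| ^ (1 - γ)

/-- `‖u‖_r^r = ∫_Ω |u|^r dx`. -/
def powerTerm (r : ℝ) (u : W0 Ω p) : ℝ :=
  ∫ x in Ω, |u.toFun x| ^ r

/-- The energy functional of the problem
`-div(ξ |∇u|^{p-2} ∇u) = a u^{-γ} + lam u^{r-1}` in `Ω`, `u = 0` on `∂Ω`. -/
def energy (ξ a : E N → ℝ) (γ r lam : ℝ) (u : W0 Ω p) : ℝ :=
  1 / p * gradTerm ξ u - 1 / (1 - γ) * singularTerm a γ u - lam / r * powerTerm r u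

/-- The Nehari manifold; `u ≠ 0` is meant in the Sobolev space, i.e. up to null sets. -/
def nehari (Ω : Set (E N)) (p : ℝ) (ξ a : E N → ℝ) (γ r lam : ℝ) : Set (W0 Ω p) :=
  {u | gradTerm ξ u = singularTerm a γ u + lam * powerTerm r u ∧
    ¬ (∀ᵐ x ∂(volume.restrict Ω), u.toFun x = 0)}

/-- The part `N_lam^+` of the Nehari manifold. -/
def nehariPlus (Ω : Set (E N)) (p : ℝ) (ξ a : E N → ℝ) (γ r lam : ℝ) : Set (W0 Ω p) :=
  {u | u ∈ nehari Ω p ξ a γ r lam ∧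
    0 < (p + γ - 1) * gradTerm ξ u - lam * (r + γ - 1) * powerTerm r u}

/-- Weak solutions of `-div(ξ |∇u|^{p-2} ∇u) = a u^{-γ} + lam u^{r-1}` in `Ω`, `u = 0` on `∂Ω`.
Since `u^{-γ}` makes sense only where `u > 0`, positivity almost everywhere is part of the
definition, and so is the existence of all integrals in the weak formulation. -/
structure IsWeakSolution (ξ a : E N → ℝ) (γ r lam : ℝ) (u : W0 Ω p) : Prop where
  pos : ∀ᵐ x ∂(volume.restrict Ω), 0 < u.toFun x
  integrable_flux : ∀ h : W0 Ω p, IntegrableOn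
    (fun x => ξ x * (‖u.grad x‖ ^ (p - 2) * inner ℝ (u.grad x) (h.grad x))) Ω
  integrable_singular : ∀ h : W0 Ω p, IntegrableOn
    (fun x => a x * u.toFun x ^ (-γ) * h.toFun x) Ω
  integrable_power : ∀ h : W0 Ω p, IntegrableOn
    (fun x => u.toFun x ^ (r - 1) * h.toFun x) Ω
  weak_eq : ∀ h : W0 Ω p,
    ∫ x in Ω, ξ x * (‖u.grad x‖ ^ (p - 2) * inner ℝ (u.grad x) (h.grad x)) =
      (∫ x in Ω, a x * u.toFun x ^ (-γ) * h.toFun x) +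
        lam * ∫ x in Ω, u.toFun x ^ (r - 1) * h.toFun x

end SingularPLaplace

end

/-!
The point of the argument is that a minimizer `u` of the energy on `N_lam^+` minimizes the energy,
locally, along every line `t ↦ u + t h` in `W₀^{1,p}(Ω)`. On `N_lam^+` the derivative of the fibre
map `s ↦ energy (s v)` changes sign from negative to positive at `s = 1`, and this persists for `v`
near `u`: for small `t` there is `s` near `1` with `s (u + t h) ∈ N_lam^+`, and this `s` minimizes
the fibre map of `u + t h` near `1`, so that
`energy u ≤ energy (s (u + t h)) ≤ energy (u + t h)`
(`eventually_exists_fiber_scaling`, `eventually_energy_le_energy_add_smul`).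

The gradient term and the power term are differentiable along lines
(`hasDerivAt_integral_norm_rpow`); for the latter one needs `W₀^{1,p}(Ω) ⊆ L^r(Ω)`, which follows
from the Gagliardo-Nirenberg-Sobolev inequality. The singular term is not known to be
differentiable at first. For a test function `h ≥ 0`, however, its difference quotients for `t > 0`
are nonnegative and have bounded integrals, so by Fatou's lemma
(`ae_pos_and_lintegral_le_of_hasDerivAt`) their pointwise limit is integrable. This limit is
infinite where `u = 0 < h`, hence `u > 0` almost everywhere without any strong maximum principle,
and `∫ a u^{-γ} h` is bounded by the derivative of the two other terms. Applied to the smoothed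
absolute values `√(φ² + ε²) - ε` of test functions `φ` approximating `h`, this bound gives
integrability of `a u^{-γ} h` for every `h ∈ W₀^{1,p}(Ω)`.

Finally, `||v + s|^q - v^q| ≤ v^{q-1} |s|` for `v > 0`, so `a u^{-γ} |h|` dominates the difference
quotients of the singular term and the energy is differentiable along `t ↦ u + t h`
(`hasDerivAt_integral_abs_rpow`). Its derivative at the local minimum `t = 0` vanishes, which is the
weak formulation. Since `h` is of arbitrary sign throughout, no truncation of Sobolev functions
is needed.
-/

noncomputable section

namespace SingularPLaplace

/-! ### Integral functionals along a line -/

theorem abs_norm_rpow_mul_inner_le {F : Type*} [NormedAddCommGroup F] [InnerProductSpace ℝ F]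
    {p M : ℝ} (hp : 1 < p) {y k : F} (hy : ‖y‖ ≤ M) (hk : ‖k‖ ≤ M) :
    |‖y‖ ^ (p - 2) * inner ℝ y k| ≤ M ^ p := by
  have hM : 0 ≤ M := (norm_nonneg _).trans hy
  rcases eq_or_ne y 0 with rfl | h0
  · simpa using Real.rpow_nonneg hM p
  have hy0 : 0 < ‖y‖ := norm_pos_iff.2 h0
  have hM0 : 0 < M := hy0.trans_le hy
  calc |‖y‖ ^ (p - 2) * inner ℝ y k| ≤ ‖y‖ ^ (p - 2) * (‖y‖ * ‖k‖) := by
        rw [abs_mul, abs_of_nonneg (Real.rpow_nonneg hy0.le _)]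
        gcongr
        exact abs_real_inner_le_norm y k
    _ = ‖y‖ ^ (p - 1) * ‖k‖ := by
        rw [← mul_assoc, ← Real.rpow_add_one hy0.ne']; ring_nf
    _ ≤ M ^ (p - 1) * M := by
        have : 0 ≤ p - 1 := by linarith
        gcongr
    _ = M ^ p := by rw [← Real.rpow_add_one hM0.ne']; ring_nf

theorem integrable_mul_norm_add_norm_rpow {α : Type*} [MeasurableSpace α] {μ : Measure α}
    {F : Type*} [NormedAddCommGroup F] {p : ℝ} (hp : 1 < p) {w : α → ℝ} (hw : MemLp w ⊤ μ)
    {f k : α → F} (hf : MemLp f (ENNReal.ofReal p) μ) (hk : MemLp k (ENNReal.ofReal p) μ) :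
    Integrable (fun x => |w x| * (‖f x‖ + ‖k x‖) ^ p) μ := by
  have h1 : MemLp (fun x => ‖f x‖ + ‖k x‖) (ENNReal.ofReal p) μ := hf.norm.add hk.norm
  have h2 := h1.integrable_norm_rpow (by simpa using by linarith) (by simp)
  rw [ENNReal.toReal_ofReal (by linarith)] at h2
  have h3 : Integrable (fun x => (‖f x‖ + ‖k x‖) ^ p) μ := by
    refine h2.congr (Eventually.of_forall fun x => ?_)
    simp only [Real.norm_eq_abs]
    rw [abs_of_nonneg (by positivity)]
  have := h3.mul_of_top_right hw.norm
  simpa [Pi.mul_def, mul_comm] using this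

/-- Differentiability of `t ↦ ∫ w ‖f + t k‖ ^ p` for `f, k` in `L^p`. It serves the gradient term
and, with real values and exponent `r`, the power term. -/
theorem hasDerivAt_integral_norm_rpow {α : Type*} [MeasurableSpace α] {μ : Measure α}
    {F : Type*} [NormedAddCommGroup F] [InnerProductSpace ℝ F] {p : ℝ} (hp : 1 < p)
    {w : α → ℝ} (hw : MemLp w ⊤ μ) {f k : α → F} (hf : MemLp f (ENNReal.ofReal p) μ)
    (hk : MemLp k (ENNReal.ofReal p) μ) :
    Integrable (fun x => w x * (‖f x‖ ^ (p - 2) * inner ℝ (f x) (k x))) μ ∧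
    HasDerivAt (fun t : ℝ => ∫ x, w x * ‖f x + t • k x‖ ^ p ∂μ)
      (p * ∫ x, w x * (‖f x‖ ^ (p - 2) * inner ℝ (f x) (k x)) ∂μ) 0 := by
  have hint := integrable_mul_norm_add_norm_rpow hp hw hf hk
  have hmeas : ∀ t : ℝ, AEStronglyMeasurable (fun x => w x * ‖f x + t • k x‖ ^ p) μ := fun t =>
    hw.1.mul ((hf.1.add (hk.1.const_smul t)).norm.aemeasurable.pow_const p).aestronglyMeasurable
  have hmeas' : AEStronglyMeasurable
      (fun x => w x * (‖f x‖ ^ (p - 2) * inner ℝ (f x) (k x))) μ :=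
    hw.1.mul ((hf.1.norm.aemeasurable.pow_const _).aestronglyMeasurable.mul (hf.1.inner hk.1))
  have hle : ∀ t ∈ Metric.ball (0 : ℝ) 1, ∀ x, ‖f x + t • k x‖ ≤ ‖f x‖ + ‖k x‖ := by
    intro t ht x
    refine (norm_add_le _ _).trans ?_
    rw [norm_smul]
    have : ‖t‖ ≤ 1 := by simpa using (mem_ball_zero_iff.1 ht).le
    nlinarith [norm_nonneg (k x)]
  have hk_le : ∀ x, ‖k x‖ ≤ ‖f x‖ + ‖k x‖ := fun x => by linarith [norm_nonneg (f x)]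
  have key := hasDerivAt_integral_of_dominated_loc_of_deriv_le (μ := μ) (𝕜 := ℝ) (x₀ := 0)
    (F := fun t x => w x * ‖f x + t • k x‖ ^ p)
    (F' := fun t x => w x * (p * (‖f x + t • k x‖ ^ (p - 2) * inner ℝ (f x + t • k x) (k x))))
    (bound := fun x => p * (|w x| * (‖f x‖ + ‖k x‖) ^ p))
    (Metric.ball_mem_nhds 0 one_pos) (Eventually.of_forall hmeas) ?_ ?_ ?_ (hint.const_mul p) ?_
  · have h2 := key.2
    have h1 : Integrable (fun x => w x * (‖f x‖ ^ (p - 2) * inner ℝ (f x) (k x))) μ := by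
      refine hint.mono' hmeas' (Eventually.of_forall fun x => ?_)
      rw [norm_mul, Real.norm_eq_abs, Real.norm_eq_abs]
      gcongr
      exact abs_norm_rpow_mul_inner_le hp (by linarith [norm_nonneg (k x)]) (hk_le x)
    refine ⟨h1, ?_⟩
    refine h2.congr_deriv ?_
    rw [← integral_const_mul]
    refine integral_congr_ae (Eventually.of_forall fun x => ?_)
    simp only [zero_smul, add_zero]
    ring
  · refine hint.mono' (hmeas 0) (Eventually.of_forall fun x => ?_)
    rw [norm_mul, Real.norm_eq_abs, Real.norm_of_nonneg (by positivity)]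
    have := hle 0 (by simp) x
    gcongr
  · refine (hmeas'.const_mul p).congr (Eventually.of_forall fun x => ?_)
    simp only [zero_smul, add_zero]
    ring
  · refine Eventually.of_forall fun x t ht => ?_
    rw [norm_mul, norm_mul, Real.norm_eq_abs, Real.norm_eq_abs, Real.norm_eq_abs,
      abs_of_pos (by linarith : 0 < p)]
    have := abs_norm_rpow_mul_inner_le hp (hle t ht x) (hk_le x)
    calc _ ≤ |w x| * (p * (‖f x‖ + ‖k x‖) ^ p) := by gcongr
      _ = _ := by ring
  · refine Eventually.of_forall fun x t _ => ?_
    have h1 : HasDerivAt (fun t : ℝ => f x + t • k x) (k x) t := by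
      simpa using ((hasDerivAt_id t).smul_const (k x)).const_add (f x)
    have h2 := (hasFDerivAt_norm_rpow (f x + t • k x) hp).comp_hasDerivAt t h1
    refine (h2.const_mul (w x)).congr_deriv ?_
    simp only [smul_apply, innerSL_apply_apply, smul_eq_mul]
    ring

/-- A bound valid for all increments `s`, of either sign and any size, although `z ↦ |z| ^ q` is not
Lipschitz near `0`: it makes `v ^ (q - 1) * |k|` a dominating function for all difference
quotients of `t ↦ |v + t * k| ^ q` at `0`. -/
theorem abs_abs_add_rpow_sub_le {q v : ℝ} (hq0 : 0 < q) (hq1 : q ≤ 1) (hv : 0 < v) (s : ℝ) :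
    |(|v + s| ^ q - v ^ q)| ≤ v ^ (q - 1) * |s| := by
  have hw : 0 ≤ |v + s| := abs_nonneg _
  have h1 : |(|v + s| - v)| ≤ |s| := by
    have := abs_abs_sub_abs_le (v + s) v
    rwa [abs_of_pos hv, add_sub_cancel_left] at this
  have h2 : |(|v + s| ^ q - v ^ q)| ≤ v ^ (q - 1) * |(|v + s| - v)| := by
    generalize |v + s| = z at hw
    have hvq : v ^ q = v ^ (q - 1) * v := by
      rw [← Real.rpow_add_one hv.ne']; ring_nf
    rcases le_total v z with hvz | hvz
    · have hz : 0 < z := hv.trans_le hvz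
      have hzq : z ^ q = z ^ (q - 1) * z := by
        rw [← Real.rpow_add_one hz.ne']; ring_nf
      have := Real.rpow_le_rpow hv.le hvz hq0.le
      rw [abs_of_nonneg (by linarith), abs_of_nonneg (by linarith)]
      have := Real.rpow_le_rpow_of_nonpos hv hvz (by linarith : q - 1 ≤ 0)
      rw [hvq, hzq]
      nlinarith
    · have := Real.rpow_le_rpow hw hvz hq0.le
      rw [abs_of_nonpos (by linarith), abs_of_nonpos (by linarith)]
      have : v ^ (q - 1) * z ≤ z ^ q := by
        rcases hw.eq_or_lt with rfl | hz
        · simpa using Real.rpow_nonneg le_rfl q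
        have hzq : z ^ q = z ^ (q - 1) * z := by
          rw [← Real.rpow_add_one hz.ne']; ring_nf
        rw [hzq]
        exact mul_le_mul_of_nonneg_right
          (Real.rpow_le_rpow_of_nonpos hz hvz (by linarith)) hw
      rw [hvq]
      linarith
  refine h2.trans ?_
  gcongr

theorem hasDerivAt_abs_add_mul_rpow {q v : ℝ} (hv : 0 < v) (k : ℝ) :
    HasDerivAt (fun t : ℝ => |v + t * k| ^ q) (q * (v ^ (q - 1) * k)) 0 := by
  have h1 : HasDerivAt (fun t : ℝ => v + t * k) k 0 := by
    simpa using ((hasDerivAt_id (0 : ℝ)).mul_const k).const_add v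
  have h2 := h1.rpow_const (p := q) (Or.inl (by simpa using hv.ne'))
  have h3 : ∀ᶠ t : ℝ in 𝓝 0, 0 < v + t * k :=
    h1.continuousAt.eventually (lt_mem_nhds (by simpa using hv))
  refine HasDerivAt.congr_of_eventuallyEq (f := fun t : ℝ => (v + t * k) ^ q) ?_ ?_
  · refine h2.congr_deriv ?_
    simp only [zero_mul, add_zero]
    ring
  · filter_upwards [h3] with t ht
    rw [abs_of_pos ht]

theorem integrable_mul_abs_rpow {α : Type*} [MeasurableSpace α] {μ : Measure α}
    {q : ℝ} (hq0 : 0 < q) (hq1 : q ≤ 1) {a : α → ℝ} (ha : MemLp a ⊤ μ) [IsFiniteMeasure μ]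
    {f : α → ℝ} (hf : Integrable f μ) : Integrable (fun x => a x * |f x| ^ q) μ := by
  have h1 : Integrable (fun x => |f x| ^ q) μ := by
    refine ((integrable_const (1 : ℝ)).add hf.norm).mono'
      (hf.1.norm.aemeasurable.pow_const q).aestronglyMeasurable (Eventually.of_forall fun x => ?_)
    rw [Real.norm_of_nonneg (by positivity)]
    have h0 := abs_nonneg (f x)
    simp only [Pi.add_apply, Real.norm_eq_abs]
    calc |f x| ^ q ≤ (1 + |f x|) ^ q := by gcongr; linarith
      _ ≤ (1 + |f x|) ^ (1 : ℝ) := Real.rpow_le_rpow_of_exponent_le (by linarith) hq1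
      _ = _ := Real.rpow_one _
  simpa [Pi.mul_def, mul_comm] using h1.mul_of_top_right ha

/-- The singular term is differentiable along a line through a positive `f` as soon as the formal
derivative is integrable. -/
theorem hasDerivAt_integral_abs_rpow {α : Type*} [MeasurableSpace α] {μ : Measure α}
    [IsFiniteMeasure μ] {q : ℝ} (hq0 : 0 < q) (hq1 : q ≤ 1) {a : α → ℝ} (ha : MemLp a ⊤ μ)
    {f k : α → ℝ} (hf : Integrable f μ) (hk : Integrable k μ) (hpos : ∀ᵐ x ∂μ, 0 < f x)
    (hint : Integrable (fun x => a x * f x ^ (q - 1) * k x) μ) :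
    HasDerivAt (fun t : ℝ => ∫ x, a x * |f x + t * k x| ^ q ∂μ)
      (q * ∫ x, a x * f x ^ (q - 1) * k x ∂μ) 0 := by
  -- The Lipschitz bound holds only with base point `0`, so the Fréchet version, which asks for
  -- nothing more, is used; `L` turns numbers into linear maps.
  set L : ℝ →L[ℝ] ℝ →L[ℝ] ℝ := ContinuousLinearMap.smulRightL ℝ ℝ ℝ 1
  have hint' := hint.const_mul q
  have key := hasFDerivAt_integral_of_dominated_loc_of_lip' (μ := μ) (𝕜 := ℝ) (x₀ := (0 : ℝ))
    (F := fun t x => a x * |f x + t * k x| ^ q)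
    (F' := fun x => L (q * (a x * f x ^ (q - 1) * k x)))
    (bound := fun x => ‖a x * f x ^ (q - 1) * k x‖) univ_mem ?_ ?_ ?_ ?_ hint.norm ?_
  · have h := key.2
    rw [ContinuousLinearMap.integral_comp_comm L hint', integral_const_mul] at h
    exact h
  · intro t _
    exact (integrable_mul_abs_rpow hq0 hq1 ha (hf.add (hk.const_mul t))).1
  · simpa using integrable_mul_abs_rpow hq0 hq1 ha hf
  · exact L.continuous.comp_aestronglyMeasurable hint'.1
  · filter_upwards [hpos] with x hx t _
    rw [← mul_sub, norm_mul, norm_mul, norm_mul, mul_assoc, mul_assoc]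
    gcongr
    have := abs_abs_add_rpow_sub_le hq0 hq1 hx (t * k x)
    simp only [zero_mul, add_zero, sub_zero, Real.norm_eq_abs]
    rw [abs_of_pos hx, abs_of_nonneg (Real.rpow_nonneg hx.le _)]
    rw [abs_mul] at this
    linarith
  · filter_upwards [hpos] with x hx
    have := ((hasDerivAt_abs_add_mul_rpow (q := q) hx (k x)).const_mul (a x)).congr_deriv
      (g' := q * (a x * f x ^ (q - 1) * k x)) (by ring)
    exact this.hasFDerivAt

theorem continuousAt_integral_abs_rpow {α : Type*} [MeasurableSpace α] {μ : Measure α}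
    [IsFiniteMeasure μ] {q : ℝ} (hq0 : 0 < q) (hq1 : q ≤ 1) {a : α → ℝ} (ha : MemLp a ⊤ μ)
    {f k : α → ℝ} (hf : Integrable f μ) (hk : Integrable k μ) :
    ContinuousAt (fun t : ℝ => ∫ x, a x * |f x + t * k x| ^ q ∂μ) 0 := by
  refine continuousAt_of_dominated (bound := fun x => ‖a x * |(|f x| + |k x|)| ^ q‖)
    (Eventually.of_forall fun t =>
      (integrable_mul_abs_rpow hq0 hq1 ha (hf.add (hk.const_mul t))).1) ?_
    (integrable_mul_abs_rpow hq0 hq1 ha (hf.norm.add hk.norm)).norm ?_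
  · filter_upwards [Metric.ball_mem_nhds (0 : ℝ) one_pos] with t ht
    refine Eventually.of_forall fun x => ?_
    rw [norm_mul, norm_mul]
    have ht1 : |t| ≤ 1 := by simpa using (mem_ball_zero_iff.1 ht).le
    have : |f x + t * k x| ≤ |(|f x| + |k x|)| := by
      rw [abs_of_nonneg (by positivity : 0 ≤ |f x| + |k x|)]
      refine (abs_add_le _ _).trans ?_
      rw [abs_mul]
      nlinarith [abs_nonneg (k x)]
    rw [Real.norm_of_nonneg (by positivity : 0 ≤ |f x + t * k x| ^ q),
      Real.norm_of_nonneg (by positivity : 0 ≤ |(|f x| + |k x|)| ^ q)]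
    gcongr
  · refine Eventually.of_forall fun x => ?_
    have : Continuous fun t : ℝ => |f x + t * k x| ^ q :=
      Continuous.rpow_const (by fun_prop) fun _ => Or.inr hq0.le
    exact (this.const_mul (a x)).continuousAt

/-! ### One-sided variations and Fatou's lemma -/

/-- If increments of the concave term in the nonnegative direction `k` are controlled by those of a
function `S` with derivative `l` at `0`, then `f` is positive where `k` is, and the formal
derivative of the concave term is at most `l`. This is Fatou's lemma for the difference quotients,
which blow up where `f = 0 < k`. -/
theorem ae_pos_and_lintegral_le_of_hasDerivAt {α : Type*} [MeasurableSpace α] {μ : Measure α}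
    {q : ℝ} (hq0 : 0 < q) (hq1 : q < 1) {a f k : α → ℝ} (ha : ∀ᵐ x ∂μ, 0 < a x)
    (hf : ∀ᵐ x ∂μ, 0 ≤ f x) (hk : ∀ᵐ x ∂μ, 0 ≤ k x)
    (hint : ∀ t : ℝ, Integrable (fun x => a x * |f x + t * k x| ^ q) μ)
    {S : ℝ → ℝ} {l : ℝ} (hS : HasDerivAt S l 0)
    (hle : ∀ᶠ t in 𝓝 (0 : ℝ), 1 / q * ((∫ x, a x * |f x + t * k x| ^ q ∂μ) -
      ∫ x, a x * |f x| ^ q ∂μ) ≤ S t - S 0) :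
    (∀ᵐ x ∂μ, 0 < k x → 0 < f x) ∧
      ∫⁻ x, ENNReal.ofReal (a x * f x ^ (q - 1) * k x) ∂μ ≤ ENNReal.ofReal l := by
  have htend : Tendsto (fun n : ℕ => 1 / ((n : ℝ) + 1)) atTop (𝓝[>] 0) :=
    tendsto_nhdsWithin_iff.2 ⟨tendsto_one_div_add_atTop_nhds_zero_nat,
      Eventually.of_forall fun n => by simp; positivity⟩
  set τ : ℕ → ℝ := fun n => 1 / ((n : ℝ) + 1) with hτ
  have hτpos : ∀ n, 0 < τ n := fun n => by simp only [hτ]; positivity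
  have htend' : Tendsto τ atTop (𝓝[≠] 0) :=
    htend.mono_right (nhdsWithin_mono _ fun t ht => (ne_of_gt ht))
  have hint0 : Integrable (fun x => a x * |f x| ^ q) μ := by simpa using hint 0
  set D : ℕ → α → ℝ := fun n x =>
    (τ n)⁻¹ * (1 / q * (a x * |f x + τ n * k x| ^ q - a x * |f x| ^ q)) with hD
  have hDint : ∀ n, Integrable (D n) μ := fun n =>
    (((hint (τ n)).sub hint0).const_mul (1 / q)).const_mul _
  have hDnonneg : ∀ n, 0 ≤ᵐ[μ] D n := fun n => by
    filter_upwards [ha, hf, hk] with x hax hfx hkx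
    have h1 := hτpos n
    have h2 : |f x| ^ q ≤ |f x + τ n * k x| ^ q := by
      rw [abs_of_nonneg hfx, abs_of_nonneg (by positivity)]
      gcongr
      nlinarith [mul_nonneg h1.le hkx]
    have h3 : a x * |f x| ^ q ≤ a x * |f x + τ n * k x| ^ q := by gcongr
    have h4 : 0 ≤ a x * |f x + τ n * k x| ^ q - a x * |f x| ^ q := by linarith
    simp only [hD, Pi.zero_apply]
    positivity
  have hslope : Tendsto (fun n => (τ n)⁻¹ * (S (τ n) - S 0)) atTop (𝓝 l) := by
    simpa [slope_fun_def, Function.comp_def] using hS.tendsto_slope.comp htend'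
  have hDle : ∀ᶠ n in atTop, ∫⁻ x, ENNReal.ofReal (D n x) ∂μ ≤
      ENNReal.ofReal ((τ n)⁻¹ * (S (τ n) - S 0)) := by
    filter_upwards [(htend.mono_right nhdsWithin_le_nhds).eventually hle] with n hn
    rw [← ofReal_integral_eq_lintegral_ofReal (hDint n) (hDnonneg n)]
    refine ENNReal.ofReal_le_ofReal ?_
    simp only [hD]
    rw [integral_const_mul, integral_const_mul, integral_sub (hint _) hint0]
    have h1 := hτpos n
    gcongr
  set G : α → ENNReal := fun x => liminf (fun n => ENNReal.ofReal (D n x)) atTop with hG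
  have hGle : ∫⁻ x, G x ∂μ ≤ ENNReal.ofReal l := by
    refine (lintegral_liminf_le' fun n => (hDint n).1.aemeasurable.ennreal_ofReal).trans ?_
    refine (liminf_le_liminf hDle).trans ?_
    exact ((ENNReal.continuous_ofReal.tendsto l).comp hslope).liminf_eq.le
  have hGmeas : AEMeasurable G μ := by
    simp only [hG, liminf_eq_iSup_iInf_of_nat]
    exact AEMeasurable.iSup fun n => AEMeasurable.biInf _ (Set.to_countable _) fun i _ =>
      (hDint i).1.aemeasurable.ennreal_ofReal
  have hGtop : ∀ᵐ x ∂μ, G x < ⊤ :=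
    ae_lt_top' hGmeas (hGle.trans_lt ENNReal.ofReal_lt_top).ne
  have hpos : ∀ᵐ x ∂μ, 0 < k x → 0 < f x := by
    filter_upwards [hGtop, ha, hf] with x hGx hax hfx hkx
    by_contra hneg
    have hfx0 : f x = 0 := le_antisymm (not_lt.1 hneg) hfx
    refine hGx.ne ?_
    have hlim : Tendsto (fun n => D n x) atTop atTop := by
      have h1 : Tendsto (fun t : ℝ => t ^ (q - 1)) (𝓝[>] 0) atTop :=
        tendsto_rpow_neg_nhdsGT_zero (by linarith)
      have h2 := (h1.comp htend).atTop_mul_const (r := 1 / q * (a x * k x ^ q)) (by positivity)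
      refine h2.congr fun n => ?_
      have h3 := hτpos n
      simp only [hD, Function.comp, hfx0, zero_add, abs_zero, Real.zero_rpow hq0.ne']
      rw [abs_of_pos (by positivity), Real.mul_rpow h3.le hkx.le, Real.rpow_sub_one h3.ne']
      field_simp
      ring
    exact (ENNReal.tendsto_ofReal_nhds_top.2 hlim).liminf_eq
  refine ⟨hpos, (lintegral_mono_ae ?_).trans hGle⟩
  filter_upwards [hpos, hk] with x hx hkx
  rcases hkx.eq_or_lt with h0 | h0
  · simp [← h0]
  have h1 := hx h0
  have h2 := (hasDerivAt_abs_add_mul_rpow (q := q) h1 (k x)).tendsto_slope.comp htend'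
  have h3 : Tendsto (fun n => D n x) atTop (𝓝 (a x * f x ^ (q - 1) * k x)) := by
    have h4 := (h2.const_mul (1 / q * a x))
    have h5 : 1 / q * a x * (q * (f x ^ (q - 1) * k x)) = a x * f x ^ (q - 1) * k x := by
      field_simp
    rw [h5] at h4
    refine h4.congr fun n => ?_
    simp only [hD, slope_fun_def, Function.comp, smul_eq_mul, vsub_eq_sub, sub_zero, zero_mul,
      add_zero]
    ring
  exact ((ENNReal.continuous_ofReal.tendsto _).comp h3).liminf_eq.ge

/-! ### The fibre map -/

/-- `A t`, `B t`, `P t` stand for the gradient, singular and power terms of a family of functions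
`w t`. If `w 0` lies in `N_lam^+`, then for small `t` some multiple `s w t` satisfies the two
conditions defining `N_lam^+` and has at most the energy of `w t`. -/
theorem eventually_exists_fiber_scaling {p r γ lam : ℝ} (hγ1 : γ < 1) (hp : p ≠ 0) (hr : r ≠ 0)
    {A B P : ℝ → ℝ} (hA : ContinuousAt A 0) (hB : ContinuousAt B 0) (hP : ContinuousAt P 0)
    (heq : A 0 = B 0 + lam * P 0)
    (hpos : 0 < (p + γ - 1) * A 0 - lam * (r + γ - 1) * P 0) :
    ∀ᶠ t in 𝓝 (0 : ℝ), ∃ s : ℝ, 0 < s ∧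
      s ^ p * A t = s ^ (1 - γ) * B t + lam * (s ^ r * P t) ∧
      0 < (p + γ - 1) * (s ^ p * A t) - lam * (r + γ - 1) * (s ^ r * P t) ∧
      1 / p * (s ^ p * A t) - 1 / (1 - γ) * (s ^ (1 - γ) * B t) - lam / r * (s ^ r * P t) ≤
        1 / p * A t - 1 / (1 - γ) * B t - lam / r * P t := by
  -- The derivative of the fibre map is `s ^ (-γ)` times `m t s`, and the sign of the `s`-derivative
  -- of `m t` is that of `d t s`, which is positive near `(0, 1)`.
  set m : ℝ → ℝ → ℝ := fun t s => s ^ (p + γ - 1) * A t - B t - lam * (s ^ (r + γ - 1) * P t)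
  set d : ℝ → ℝ → ℝ := fun t s => (p + γ - 1) * (s ^ p * A t) - lam * (r + γ - 1) * (s ^ r * P t)
  have hrpow : ∀ e : ℝ, Tendsto (fun z : ℝ × ℝ => z.2 ^ e) (𝓝 (0, 1)) (𝓝 1) := fun e => by
    have : ContinuousAt (fun z : ℝ × ℝ => z.2 ^ e) (0, 1) :=
      continuousAt_snd.rpow_const (Or.inl one_ne_zero)
    simpa [ContinuousAt] using this
  have hfst : Tendsto (fun z : ℝ × ℝ => z.1) (𝓝 (0, 1)) (𝓝 0) := continuousAt_fst
  have hd : Tendsto (fun z : ℝ × ℝ => d z.1 z.2) (𝓝 (0, 1))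
      (𝓝 ((p + γ - 1) * (1 * A 0) - lam * (r + γ - 1) * (1 * P 0))) :=
    (((hrpow p).mul (hA.tendsto.comp hfst)).const_mul _).sub
      (((hrpow r).mul (hP.tendsto.comp hfst)).const_mul _)
  have hd_pos := hd.eventually (lt_mem_nhds (by simpa only [one_mul] using hpos))
  rw [nhds_prod_eq] at hd_pos
  obtain ⟨T, hT, V, hV, hTV⟩ := eventually_prod_iff.1 hd_pos
  obtain ⟨δ, hδ, hδV⟩ := Metric.eventually_nhds_iff_ball.1 hV
  obtain ⟨η, hη0, hηδ, hη1⟩ : ∃ η > 0, η < δ ∧ η < 1 :=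
    ⟨min δ 1 / 2, by positivity, by have := min_le_left δ 1; linarith [lt_min hδ one_pos],
      by have := min_le_right δ 1; linarith⟩
  have hIV : ∀ s ∈ Set.Icc (1 - η) (1 + η), V s := fun s hs => hδV s (by
    rw [Metric.mem_ball, Real.dist_eq, abs_lt]; constructor <;> linarith [hs.1, hs.2])
  have hIpos : ∀ s ∈ Set.Icc (1 - η) (1 + η), 0 < s := fun s hs => by linarith [hs.1]
  have hderiv : ∀ t, ∀ s > 0, HasDerivAt (m t) (s ^ (γ - 1 - 1) * d t s) s := by
    intro t s hs
    have h1 := (Real.hasDerivAt_rpow_const (p := p + γ - 1) (Or.inl hs.ne')).mul_const (A t)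
    have h2 := ((Real.hasDerivAt_rpow_const (p := r + γ - 1) (Or.inl hs.ne')).mul_const
      (P t)).const_mul lam
    refine ((h1.sub_const (B t)).sub h2).congr_deriv ?_
    have e1 : s ^ (p + γ - 1 - 1) = s ^ (γ - 1 - 1) * s ^ p := by
      rw [← Real.rpow_add hs]; ring_nf
    have e2 : s ^ (r + γ - 1 - 1) = s ^ (γ - 1 - 1) * s ^ r := by
      rw [← Real.rpow_add hs]; ring_nf
    rw [e1, e2]
    simp only [d]
    ring
  -- Hence `m t` has exactly one zero in a fixed interval about `1`, where the fibre map is minimal.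
  have hmono : ∀ t, T t → StrictMonoOn (m t) (Set.Icc (1 - η) (1 + η)) := by
    intro t ht
    refine strictMonoOn_of_deriv_pos (convex_Icc _ _)
      (fun s hs => (hderiv t s (hIpos s hs)).continuousAt.continuousWithinAt) fun s hs => ?_
    have hs' := interior_subset hs
    rw [(hderiv t s (hIpos s hs')).deriv]
    exact mul_pos (Real.rpow_pos_of_pos (hIpos s hs') _) (hTV ht (hIV s hs'))
  have hm : ∀ s, ContinuousAt (fun t => m t s) 0 := fun s =>
    ((hA.const_mul _).sub hB).sub ((hP.const_mul _).const_mul _)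
  have hm01 : m 0 1 = 0 := by simp only [m, Real.one_rpow]; linarith
  have h0 := hmono 0 hT.self_of_nhds
  have hleft : (1 - η) ∈ Set.Icc (1 - η) (1 + η) := ⟨le_rfl, by linarith⟩
  have hright : (1 + η) ∈ Set.Icc (1 - η) (1 + η) := ⟨by linarith, le_rfl⟩
  have hone : (1 : ℝ) ∈ Set.Icc (1 - η) (1 + η) := ⟨by linarith, by linarith⟩
  have hlt : m 0 (1 - η) < 0 := (h0 hleft hone (by linarith)).trans_eq hm01
  have hgt : 0 < m 0 (1 + η) := hm01.symm.trans_lt (h0 hone hright (by linarith))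
  filter_upwards [hT, (hm (1 - η)).eventually (gt_mem_nhds hlt),
    (hm (1 + η)).eventually (lt_mem_nhds hgt)] with t ht htl htr
  have hcont : ContinuousOn (m t) (Set.Icc (1 - η) (1 + η)) := fun s hs =>
    (hderiv t s (hIpos s hs)).continuousAt.continuousWithinAt
  obtain ⟨s, hs, hms⟩ := intermediate_value_Icc (by linarith) hcont ⟨htl.le, htr.le⟩
  have hs0 := hIpos s hs
  have hfib : ∀ s > 0, s ^ (1 - γ) * m t s =
      s ^ p * A t - s ^ (1 - γ) * B t - lam * (s ^ r * P t) := by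
    intro s hs
    have e1 : s ^ p = s ^ (1 - γ) * s ^ (p + γ - 1) := by
      rw [← Real.rpow_add hs]; ring_nf
    have e2 : s ^ r = s ^ (1 - γ) * s ^ (r + γ - 1) := by
      rw [← Real.rpow_add hs]; ring_nf
    rw [e1, e2]
    simp only [m]
    ring
  refine ⟨s, hs0, ?_, hTV ht (hIV s hs), ?_⟩
  · have := hfib s hs0
    rw [hms] at this
    linarith
  set ψ : ℝ → ℝ := fun s =>
    1 / p * (s ^ p * A t) - 1 / (1 - γ) * (s ^ (1 - γ) * B t) - lam / r * (s ^ r * P t)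
  have hψ : ∀ s > 0, HasDerivAt ψ (s ^ (-γ) * m t s) s := by
    intro s hs
    have h1 := ((Real.hasDerivAt_rpow_const (p := p) (Or.inl hs.ne')).mul_const
      (A t)).const_mul (1 / p)
    have h2 := ((Real.hasDerivAt_rpow_const (p := 1 - γ) (Or.inl hs.ne')).mul_const
      (B t)).const_mul (1 / (1 - γ))
    have h3 := ((Real.hasDerivAt_rpow_const (p := r) (Or.inl hs.ne')).mul_const
      (P t)).const_mul (lam / r)
    refine ((h1.sub h2).sub h3).congr_deriv ?_
    have e1 : s ^ (p - 1) = s ^ (-γ) * s ^ (p + γ - 1) := by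
      rw [← Real.rpow_add hs]; ring_nf
    have e2 : s ^ (r - 1) = s ^ (-γ) * s ^ (r + γ - 1) := by
      rw [← Real.rpow_add hs]; ring_nf
    have e3 : s ^ (1 - γ - 1) = s ^ (-γ) := by ring_nf
    rw [e1, e2, e3]
    simp only [m]
    have : 1 - γ ≠ 0 := by linarith
    field_simp
  have hψ1 : ψ 1 = 1 / p * A t - 1 / (1 - γ) * B t - lam / r * P t := by
    simp only [ψ, Real.one_rpow, one_mul]
  have hmle := (hmono t ht).monotoneOn
  change ψ s ≤ _
  rw [← hψ1]
  rcases le_total s 1 with h | h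
  · have hsub : Set.Icc s 1 ⊆ Set.Icc (1 - η) (1 + η) := Set.Icc_subset_Icc hs.1 hone.2
    refine monotoneOn_of_deriv_nonneg (convex_Icc s 1) (fun z hz =>
      (hψ z (hIpos z (hsub hz))).continuousAt.continuousWithinAt) (fun z hz =>
      (hψ z (hIpos z (hsub (interior_subset hz)))).differentiableAt.differentiableWithinAt)
      (fun z hz => ?_) ⟨le_rfl, h⟩ ⟨h, le_rfl⟩ h
    have hz' := interior_subset hz
    have hz0 := hIpos z (hsub hz')
    rw [(hψ z hz0).deriv]
    exact mul_nonneg (Real.rpow_nonneg hz0.le _) (hms ▸ hmle hs (hsub hz') hz'.1)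
  · have hsub : Set.Icc 1 s ⊆ Set.Icc (1 - η) (1 + η) := Set.Icc_subset_Icc hone.1 hs.2
    refine antitoneOn_of_deriv_nonpos (convex_Icc 1 s) (fun z hz =>
      (hψ z (hIpos z (hsub hz))).continuousAt.continuousWithinAt) (fun z hz =>
      (hψ z (hIpos z (hsub (interior_subset hz)))).differentiableAt.differentiableWithinAt)
      (fun z hz => ?_) ⟨le_rfl, h⟩ ⟨h, le_rfl⟩ h
    have hz' := interior_subset hz
    have hz0 := hIpos z (hsub hz')
    rw [(hψ z hz0).deriv]
    exact mul_nonpos_of_nonneg_of_nonpos (Real.rpow_nonneg hz0.le _)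
      (hms ▸ hmle (hsub hz') hs hz'.2)

/-! ### Test functions and the linear structure of the Sobolev space -/

variable {N : ℕ} {Ω : Set (E N)} {p : ℝ}

theorem norm_gradient_eq_norm_fderiv (φ : E N → ℝ) (x : E N) :
    ‖gradient φ x‖ = ‖fderiv ℝ φ x‖ := by
  rw [← toDual_gradient, LinearIsometryEquiv.norm_map]

theorem eLpNorm_gradient_eq_eLpNorm_fderiv (φ : E N → ℝ) (q : ENNReal) (μ : Measure (E N)) :
    eLpNorm (gradient φ) q μ = eLpNorm (fderiv ℝ φ) q μ :=
  eLpNorm_congr_norm_ae (Eventually.of_forall fun x => norm_gradient_eq_norm_fderiv φ x)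

theorem support_gradient_subset (φ : E N → ℝ) :
    Function.support (gradient φ) ⊆ tsupport φ := by
  intro x hx
  refine support_fderiv_subset ℝ ?_
  intro h0
  refine hx ?_
  rw [← norm_eq_zero, norm_gradient_eq_norm_fderiv, h0, norm_zero]

namespace IsTestFunction

variable {φ ψ : E N → ℝ}

theorem differentiable (hφ : IsTestFunction Ω φ) : Differentiable ℝ φ :=
  hφ.1.differentiable (by simp)

theorem continuous_gradient (hφ : IsTestFunction Ω φ) : Continuous (gradient φ) :=
  (InnerProductSpace.toDual ℝ (E N)).symm.continuous.comp (hφ.1.continuous_fderiv (by simp))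

theorem hasCompactSupport_gradient (hφ : IsTestFunction Ω φ) :
    HasCompactSupport (gradient φ) :=
  HasCompactSupport.mono' hφ.2.1 (support_gradient_subset φ)

theorem memLp (hφ : IsTestFunction Ω φ) (q : ENNReal) (μ : Measure (E N))
    [IsFiniteMeasureOnCompacts μ] : MemLp φ q μ :=
  hφ.1.continuous.memLp_of_hasCompactSupport hφ.2.1

theorem memLp_gradient (hφ : IsTestFunction Ω φ) (q : ENNReal) (μ : Measure (E N))
    [IsFiniteMeasureOnCompacts μ] : MemLp (gradient φ) q μ :=
  hφ.continuous_gradient.memLp_of_hasCompactSupport hφ.hasCompactSupport_gradient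

theorem add (hφ : IsTestFunction Ω φ) (hψ : IsTestFunction Ω ψ) :
    IsTestFunction Ω (fun x => φ x + ψ x) :=
  ⟨hφ.1.add hψ.1, hφ.2.1.add hψ.2.1,
    (tsupport_add φ ψ).trans (Set.union_subset hφ.2.2 hψ.2.2)⟩

theorem const_mul (c : ℝ) (hφ : IsTestFunction Ω φ) : IsTestFunction Ω (fun x => c * φ x) :=
  ⟨contDiff_const.mul hφ.1, hφ.2.1.mul_left,
    (closure_mono (Function.support_mul_subset_right (fun _ => c) φ)).trans hφ.2.2⟩

theorem gradient_add (hφ : IsTestFunction Ω φ) (hψ : IsTestFunction Ω ψ) (x : E N) :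
    gradient (fun x => φ x + ψ x) x = gradient φ x + gradient ψ x := by
  simp only [gradient]
  rw [fderiv_fun_add (hφ.differentiable x) (hψ.differentiable x), map_add]

theorem gradient_const_mul (c : ℝ) (hφ : IsTestFunction Ω φ) (x : E N) :
    gradient (fun x => c * φ x) x = c • gradient φ x := by
  simp only [gradient]
  rw [fderiv_const_mul (hφ.differentiable x), map_smulₛₗ]
  simp

theorem hasWeakGradient (hφ : IsTestFunction Ω φ) : HasWeakGradient Ω φ (gradient φ) := by
  intro ψ hψ
  rw [setIntegral_eq_integral_of_forall_compl_eq_zero (fun x hx => by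
      rw [image_eq_zero_of_notMem_tsupport (fun h => hx (hφ.2.2 h)), zero_smul]),
    setIntegral_eq_integral_of_forall_compl_eq_zero (fun x hx => by
      rw [image_eq_zero_of_notMem_tsupport (fun h => hx (hψ.2.2 h)), zero_smul])]
  have h1 : Integrable (fun x => φ x • gradient ψ x) volume :=
    (hφ.1.continuous.smul hψ.continuous_gradient).integrable_of_hasCompactSupport
      hφ.2.1.smul_right
  have h2 : Integrable (fun x => ψ x • gradient φ x) volume :=
    (hψ.1.continuous.smul hφ.continuous_gradient).integrable_of_hasCompactSupport
      hψ.2.1.smul_right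
  refine ext_inner_left ℝ fun v => ?_
  rw [inner_neg_right, ← integral_inner h1, ← integral_inner h2]
  simp only [inner_smul_right, inner_gradient_right, conj_trivial]
  have h1' := h1.const_inner (𝕜 := ℝ) v
  have h2' := h2.const_inner (𝕜 := ℝ) v
  simp only [inner_smul_right, inner_gradient_right, conj_trivial] at h1' h2'
  rw [integral_mul_fderiv_eq_neg_fderiv_mul_of_integrable (by simpa only [mul_comm] using h2') h1'
    ((hφ.1.continuous.mul hψ.1.continuous).integrable_of_hasCompactSupport hφ.2.1.mul_right)
    (fun x _ => hφ.differentiable x) (fun x _ => hψ.differentiable x)]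
  simp only [mul_comm]

/-- A test function, as an element of the Sobolev space. -/
def toW0 (p : ℝ) (hφ : IsTestFunction Ω φ) : W0 Ω p where
  toFun := φ
  grad := gradient φ
  memLp := hφ.memLp _ _
  memLp_grad := hφ.memLp_gradient _ _
  hasWeakGradient := hφ.hasWeakGradient
  exists_approx := ⟨fun _ => φ, fun _ => hφ, by simp, by simp⟩

end IsTestFunction

namespace W0

theorem integrable (hΩ : Bornology.IsBounded Ω) (hp : 1 ≤ p) (u : W0 Ω p) :
    IntegrableOn u.toFun Ω := by
  have : IsFiniteMeasure (volume.restrict Ω) := ⟨by simpa using hΩ.measure_lt_top⟩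
  exact u.memLp.integrable (by simpa using hp)

theorem integrable_grad (hΩ : Bornology.IsBounded Ω) (hp : 1 ≤ p) (u : W0 Ω p) :
    IntegrableOn u.grad Ω := by
  have : IsFiniteMeasure (volume.restrict Ω) := ⟨by simpa using hΩ.measure_lt_top⟩
  exact u.memLp_grad.integrable (by simpa using hp)

/-- The sum of two Sobolev functions on a bounded set. -/
def add (hΩ : Bornology.IsBounded Ω) (hp : 1 ≤ p) (u v : W0 Ω p) : W0 Ω p where
  toFun x := u.toFun x + v.toFun x
  grad x := u.grad x + v.grad x
  memLp := u.memLp.add v.memLp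
  memLp_grad := u.memLp_grad.add v.memLp_grad
  hasWeakGradient φ hφ := by
    have h1 : ∀ w : W0 Ω p, IntegrableOn (fun x => w.toFun x • gradient φ x) Ω := fun w =>
      (w.integrable hΩ hp).smul_of_top_left (hφ.memLp_gradient ⊤ (volume.restrict Ω))
    have h2 : ∀ w : W0 Ω p, IntegrableOn (fun x => φ x • w.grad x) Ω := fun w =>
      (w.integrable_grad hΩ hp).smul_of_top_right (hφ.memLp ⊤ (volume.restrict Ω))
    simp only [add_smul, smul_add]
    rw [integral_add (h1 u) (h1 v), integral_add (h2 u) (h2 v), u.hasWeakGradient φ hφ,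
      v.hasWeakGradient φ hφ, neg_add]
  exists_approx := by
    obtain ⟨φ, hφ, hφ0, hφ1⟩ := u.exists_approx
    obtain ⟨ψ, hψ, hψ0, hψ1⟩ := v.exists_approx
    have hp' : 1 ≤ ENNReal.ofReal p := by simpa using hp
    refine ⟨fun n x => φ n x + ψ n x, fun n => (hφ n).add (hψ n), ?_, ?_⟩
    · refine tendsto_of_tendsto_of_tendsto_of_le_of_le tendsto_const_nhds
        (by simpa using hφ0.add hψ0) (fun _ => zero_le) fun n => ?_
      refine le_trans (le_of_eq ?_) (eLpNorm_add_le
        (((hφ n).memLp _ _).sub u.memLp).1 (((hψ n).memLp _ _).sub v.memLp).1 hp')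
      congr 1
      ext x
      simp only [Pi.add_apply]
      ring
    · refine tendsto_of_tendsto_of_tendsto_of_le_of_le tendsto_const_nhds
        (by simpa using hφ1.add hψ1) (fun _ => zero_le) fun n => ?_
      refine le_trans (le_of_eq ?_) (eLpNorm_add_le
        (((hφ n).memLp_gradient _ _).sub u.memLp_grad).1
        (((hψ n).memLp_gradient _ _).sub v.memLp_grad).1 hp')
      congr 1
      ext x
      simp only [Pi.add_apply, (hφ n).gradient_add (hψ n)]
      abel_nf

/-- A scalar multiple of a Sobolev function. -/
def smul (c : ℝ) (u : W0 Ω p) : W0 Ω p where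
  toFun x := c * u.toFun x
  grad x := c • u.grad x
  memLp := u.memLp.const_mul c
  memLp_grad := u.memLp_grad.const_smul c
  hasWeakGradient φ hφ := by
    simp only [mul_smul, smul_comm _ c]
    rw [integral_smul, integral_smul, u.hasWeakGradient φ hφ, smul_neg]
  exists_approx := by
    obtain ⟨φ, hφ, hφ0, hφ1⟩ := u.exists_approx
    refine ⟨fun n x => c * φ n x, fun n => (hφ n).const_mul c, ?_, ?_⟩
    · have h := ENNReal.Tendsto.const_mul (a := ‖c‖ₑ) hφ0 (Or.inr enorm_ne_top)
      rw [mul_zero] at h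
      refine h.congr fun n => ?_
      rw [← eLpNorm_const_smul]
      congr 1
      ext x
      simp only [Pi.smul_apply, smul_eq_mul]
      ring
    · have h := ENNReal.Tendsto.const_mul (a := ‖c‖ₑ) hφ1 (Or.inr enorm_ne_top)
      rw [mul_zero] at h
      refine h.congr fun n => ?_
      rw [← eLpNorm_const_smul]
      congr 1
      ext x
      simp only [Pi.smul_apply, (hφ n).gradient_const_mul, smul_sub]

end W0

/-! ### The Sobolev embedding -/

theorem IsTestFunction.eLpNorm_fderiv_restrict {φ : E N → ℝ} (hφ : IsTestFunction Ω φ)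
    (q : ENNReal) :
    eLpNorm (fderiv ℝ φ) q (volume.restrict Ω) = eLpNorm (fderiv ℝ φ) q volume := by
  rw [← eLpNorm_gradient_eq_eLpNorm_fderiv, ← eLpNorm_gradient_eq_eLpNorm_fderiv]
  exact eLpNorm_restrict_eq_of_support_subset ((support_gradient_subset φ).trans hφ.2.2)

theorem exists_eLpNorm_le_mul_eLpNorm_of_exponent_le {α F : Type*} [MeasurableSpace α]
    [NormedAddCommGroup F] (μ : Measure α) [IsFiniteMeasure μ] {q₁ q₂ : ENNReal} (hq₁ : 1 ≤ q₁)
    (hq : q₁ ≤ q₂) : ∃ C : ENNReal, C ≠ ⊤ ∧ ∀ f : α → F, AEStronglyMeasurable f μ →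
      eLpNorm f q₁ μ ≤ C * eLpNorm f q₂ μ := by
  refine ⟨μ Set.univ ^ (1 / q₁.toReal - 1 / q₂.toReal), ?_, fun f hf => ?_⟩
  · refine ENNReal.rpow_ne_top_of_nonneg ?_ (measure_ne_top _ _)
    rcases eq_or_ne q₂ ⊤ with rfl | h2
    · simp
    have h1 : 1 ≤ q₁.toReal := by
      simpa using ENNReal.toReal_mono (ne_top_of_le_ne_top h2 hq) hq₁
    have := ENNReal.toReal_mono h2 hq
    rw [sub_nonneg]
    exact one_div_le_one_div_of_le (by linarith) this
  · rw [mul_comm]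
    exact eLpNorm_le_eLpNorm_mul_rpow_measure_univ hq hf

/-- In dimension one, which the Gagliardo-Nirenberg-Sobolev inequality does not cover, the
fundamental theorem of calculus bounds the supremum by the `L^1` norm of the derivative. -/
theorem enorm_le_eLpNorm_fderiv_one {φ : E 1 → ℝ} (hφ : ContDiff ℝ 1 φ)
    (hc : HasCompactSupport φ) (x : E 1) : ‖φ x‖ₑ ≤ eLpNorm (fderiv ℝ φ) 1 volume := by
  let e : ℝ ≃ₗᵢ[ℝ] E 1 := (OrthonormalBasis.singleton (Fin 1) ℝ).repr
  have h1 : ContDiff ℝ 1 (φ ∘ e) := hφ.comp e.contDiff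
  have h2 : HasCompactSupport (φ ∘ e) := hc.comp_homeomorph e.toHomeomorph
  have h3 := h2.enorm_le_lintegral_Ici_deriv h1 (e.symm x)
  simp only [Function.comp_apply, e.apply_symm_apply] at h3
  refine h3.trans ((setLIntegral_le_lintegral _ _).trans ?_)
  rw [eLpNorm_one_eq_lintegral_enorm, ← e.measurePreserving.lintegral_comp_emb
    e.toHomeomorph.measurableEmbedding]
  refine lintegral_mono fun y => ?_
  have hd : HasDerivAt (φ ∘ e) (fderiv ℝ φ (e y) (e 1)) y := by
    have he : HasDerivAt e (e 1) y := by
      simpa using (e.toContinuousLinearEquiv.hasFDerivAt (x := y)).hasDerivAt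
    exact ((hφ.differentiable one_ne_zero) (e y)).hasFDerivAt.comp_hasDerivAt y he
  change ‖deriv (φ ∘ e) y‖ₑ ≤ _
  rw [hd.deriv]
  refine (ContinuousLinearMap.le_opENorm _ _).trans ?_
  rw [e.enorm_map]
  simp

/-- The subcritical Sobolev inequality for test functions on a bounded set. -/
theorem exists_sobolev_constant (hN : 1 ≤ N) (hΩ : Bornology.IsBounded Ω) {r : ℝ} (hp : 1 < p)
    (hpr : p < r) (hr : ENNReal.ofReal r < criticalExponent N p) :
    ∃ C : ENNReal, C ≠ ⊤ ∧ ∀ φ, IsTestFunction Ω φ →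
      eLpNorm φ (ENNReal.ofReal r) (volume.restrict Ω) ≤
        C * eLpNorm (gradient φ) (ENNReal.ofReal p) (volume.restrict Ω) := by
  have : IsFiniteMeasure (volume.restrict Ω) := ⟨by simpa using hΩ.measure_lt_top⟩
  have hN0 : (0 : ℝ) < N := by exact_mod_cast hN
  simp only [eLpNorm_gradient_eq_eLpNorm_fderiv]
  have hGNS : ∀ q : ℝ, 1 ≤ q → q < N → q⁻¹ - (N : ℝ)⁻¹ ≤ r⁻¹ → ∃ C : ENNReal, C ≠ ⊤ ∧
      ∀ φ, IsTestFunction Ω φ → eLpNorm φ (ENNReal.ofReal r) (volume.restrict Ω) ≤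
        C * eLpNorm (fderiv ℝ φ) (ENNReal.ofReal q) (volume.restrict Ω) := by
    intro q hq1 hqN hqr
    refine ⟨eLpNormLESNormFDerivOfLeConst ℝ (volume : Measure (E N)) Ω q.toNNReal r.toNNReal,
      ENNReal.coe_ne_top, fun φ hφ => ?_⟩
    rw [hφ.eLpNorm_fderiv_restrict,
      eLpNorm_restrict_eq_of_support_subset (subset_closure.trans hφ.2.2)]
    refine eLpNorm_le_eLpNorm_fderiv_of_le volume (hφ.1.of_le (by simp))
      (subset_closure.trans hφ.2.2) (p := q.toNNReal) (q := r.toNNReal)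
      (by simpa using hq1) ?_ ?_ hΩ
    · rw [finrank_euclideanSpace_fin, Real.toNNReal_lt_iff_lt_coe (by linarith)]
      exact_mod_cast hqN
    · rw [finrank_euclideanSpace_fin, NNReal.coe_inv, Real.coe_toNNReal _ (by linarith),
        Real.coe_toNNReal _ (by linarith)]
      exact hqr
  by_cases hpN : p < N
  · refine hGNS p hp.le hpN ?_
    rw [criticalExponent, if_pos hpN, ENNReal.ofReal_lt_ofReal_iff_of_nonneg (by linarith),
      lt_div_iff₀ (by linarith)] at hr
    have hp0 : 0 < p := by linarith
    have hr0 : 0 < r := by linarith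
    rw [inv_sub_inv hp0.ne' hN0.ne', ← one_div, div_le_div_iff₀ (by positivity) hr0]
    nlinarith
  -- If `N ≤ p`, lower the exponent of the gradient to some `q < N` whose critical exponent is still
  -- at least `r`; in dimension one, to `q = 1`.
  rw [not_lt] at hpN
  have hstep : ∀ q : ℝ, 1 ≤ q → q ≤ p → (∃ C : ENNReal, C ≠ ⊤ ∧
      ∀ φ, IsTestFunction Ω φ → eLpNorm φ (ENNReal.ofReal r) (volume.restrict Ω) ≤
        C * eLpNorm (fderiv ℝ φ) (ENNReal.ofReal q) (volume.restrict Ω)) → ∃ C : ENNReal, C ≠ ⊤ ∧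
      ∀ φ, IsTestFunction Ω φ → eLpNorm φ (ENNReal.ofReal r) (volume.restrict Ω) ≤
        C * eLpNorm (fderiv ℝ φ) (ENNReal.ofReal p) (volume.restrict Ω) := by
    rintro q hq1 hqp ⟨C, hC, h⟩
    obtain ⟨C', hC', h'⟩ := exists_eLpNorm_le_mul_eLpNorm_of_exponent_le (F := E N →L[ℝ] ℝ)
      (volume.restrict Ω) (q₁ := ENNReal.ofReal q) (q₂ := ENNReal.ofReal p) (by simpa using hq1)
      (ENNReal.ofReal_le_ofReal hqp)
    refine ⟨C * C', ENNReal.mul_ne_top hC hC', fun φ hφ => (h φ hφ).trans ?_⟩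
    rw [mul_assoc]
    gcongr
    exact h' _ (hφ.1.continuous_fderiv (by simp)).aestronglyMeasurable
  rcases hN.eq_or_lt with rfl | hN2
  · refine hstep 1 le_rfl hp.le ⟨volume.restrict Ω Set.univ ^ (ENNReal.ofReal r).toReal⁻¹,
      ENNReal.rpow_ne_top_of_nonneg (by positivity) (measure_ne_top _ _), fun φ hφ => ?_⟩
    rw [mul_comm, hφ.eLpNorm_fderiv_restrict, ENNReal.ofReal_one]
    exact eLpNorm_le_of_ae_enorm_bound (Eventually.of_forall
      (enorm_le_eLpNorm_fderiv_one (hφ.1.of_le (by simp)) hφ.2.1))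
  · have hN1 : (1 : ℝ) < N := by exact_mod_cast hN2
    have hr0 : 0 < r := by linarith
    set q : ℝ := max 1 (N * r / (N + r))
    have hqN : q < N := by
      refine max_lt hN1 ?_
      rw [div_lt_iff₀ (by positivity)]
      nlinarith
    have hq : (N : ℝ) * r / (N + r) ≤ q := le_max_right _ _
    refine hstep q (le_max_left _ _) (hqN.le.trans hpN) (hGNS q (le_max_left _ _) hqN ?_)
    have h1 := inv_anti₀ (by positivity) hq
    have h2 : ((N : ℝ) * r / (N + r))⁻¹ = r⁻¹ + (N : ℝ)⁻¹ := by
      field_simp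
    linarith

/-! ### Smoothed absolute values of test functions -/

theorem abs_sqrt_sq_add_sq_sub_sub_abs_le {ε : ℝ} (hε : 0 < ε) (y : ℝ) :
    |(√(y ^ 2 + ε ^ 2) - ε - |y|)| ≤ ε := by
  have h1 : |y| ≤ √(y ^ 2 + ε ^ 2) := Real.abs_le_sqrt (by nlinarith)
  have h2 : √(y ^ 2 + ε ^ 2) ≤ |y| + ε := by
    rw [Real.sqrt_le_left (by positivity)]
    nlinarith [abs_nonneg y, sq_abs y]
  rw [abs_le]
  constructor <;> linarith

theorem sqrt_sq_add_sq_sub_nonneg (ε y : ℝ) : 0 ≤ √(y ^ 2 + ε ^ 2) - ε :=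
  sub_nonneg.2 (Real.le_sqrt_of_sq_le (by nlinarith))

/-- `√(φ² + ε²) - ε` is a nonnegative smooth substitute for `|φ|` that vanishes where `φ` does, so
it is again a test function. -/
theorem IsTestFunction.sqrt_sq_add_sq_sub {φ : E N → ℝ} (hφ : IsTestFunction Ω φ) {ε : ℝ}
    (hε : 0 < ε) : IsTestFunction Ω (fun x => √(φ x ^ 2 + ε ^ 2) - ε) := by
  have hsub : Function.support (fun x => √(φ x ^ 2 + ε ^ 2) - ε) ⊆ Function.support φ := by
    intro x hx h0
    refine hx ?_
    simp [h0, Real.sqrt_sq hε.le]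
  refine ⟨(((hφ.1.pow 2).add contDiff_const).sqrt fun x => ?_).sub contDiff_const,
    hφ.2.1.mono hsub, (closure_mono hsub).trans hφ.2.2⟩
  positivity

theorem IsTestFunction.norm_gradient_sqrt_sq_add_sq_sub_le {φ : E N → ℝ}
    (hφ : IsTestFunction Ω φ) {ε : ℝ} (hε : 0 < ε) (x : E N) :
    ‖gradient (fun x => √(φ x ^ 2 + ε ^ 2) - ε) x‖ ≤ ‖gradient φ x‖ := by
  have hpos : 0 < φ x ^ 2 + ε ^ 2 := by positivity
  have h := ((((hφ.differentiable x).hasFDerivAt.pow 2).add_const (ε ^ 2)).sqrt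
    hpos.ne').sub_const ε
  rw [norm_gradient_eq_norm_fderiv, norm_gradient_eq_norm_fderiv, h.fderiv, norm_smul, norm_smul,
    ← mul_assoc]
  refine mul_le_of_le_one_left (norm_nonneg _) ?_
  have h1 : |φ x| ≤ √(φ x ^ 2 + ε ^ 2) := Real.abs_le_sqrt (by nlinarith)
  have h2 : 0 < √(φ x ^ 2 + ε ^ 2) := Real.sqrt_pos.2 hpos
  rw [Real.norm_of_nonneg (by positivity)]
  simp only [Nat.add_one_sub_one, pow_one, nsmul_eq_mul, Nat.cast_ofNat, norm_mul,
    Real.norm_eq_abs, abs_two]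
  rw [div_mul_eq_mul_div, div_le_one (by positivity)]
  linarith

/-! ### Approximation of Sobolev functions -/

/-- Approximation almost everywhere by test functions with bounded gradients, which is what
Fatou's lemma needs. -/
theorem W0.exists_ae_tendsto (hp : 1 ≤ p) (v : W0 Ω p) :
    ∃ φ : ℕ → E N → ℝ, (∀ n, IsTestFunction Ω (φ n)) ∧
      (∀ᵐ x ∂(volume.restrict Ω), Tendsto (fun n => φ n x) atTop (𝓝 (v.toFun x))) ∧
      ∃ M : ENNReal, M ≠ ⊤ ∧ ∀ n,
        eLpNorm (gradient (φ n)) (ENNReal.ofReal p) (volume.restrict Ω) ≤ M := by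
  obtain ⟨φ, hφ, h0, h1⟩ := v.exists_approx
  have hp' : 1 ≤ ENNReal.ofReal p := by simpa using hp
  obtain ⟨n₀, hn₀⟩ := eventually_atTop.1 (h1.eventually (gt_mem_nhds one_pos))
  obtain ⟨ns, hns, hae⟩ := (tendstoInMeasure_of_tendsto_eLpNorm (f := φ) (g := v.toFun)
    (zero_lt_one.trans_le hp').ne' (fun n => ((hφ n).memLp 1 _).1) v.memLp.1
    h0).exists_seq_tendsto_ae
  refine ⟨fun n => φ (ns (n + n₀)), fun n => hφ _, ?_,
    1 + eLpNorm v.grad (ENNReal.ofReal p) (volume.restrict Ω),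
    ENNReal.add_ne_top.2 ⟨ENNReal.one_ne_top, v.memLp_grad.2.ne⟩, fun n => ?_⟩
  · filter_upwards [hae] with x hx
    exact hx.comp (tendsto_add_atTop_nat n₀)
  · have hle := (hn₀ (ns (n + n₀)) (le_trans (by omega) (hns.le_apply (x := n + n₀)))).le
    have hadd := eLpNorm_add_le (((hφ (ns (n + n₀))).memLp_gradient _ _).sub v.memLp_grad).1
      v.memLp_grad.1 hp'
    rw [sub_add_cancel] at hadd
    exact hadd.trans (add_le_add_left hle _)

theorem W0.memLp_of_lt_criticalExponent (hN : 1 ≤ N) (hΩ : Bornology.IsBounded Ω) {r : ℝ}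
    (hp : 1 < p) (hpr : p < r) (hr : ENNReal.ofReal r < criticalExponent N p) (v : W0 Ω p) :
    MemLp v.toFun (ENNReal.ofReal r) (volume.restrict Ω) := by
  obtain ⟨C, hC, hsob⟩ := exists_sobolev_constant hN hΩ hp hpr hr
  obtain ⟨φ, hφ, hae, M, hM, hle⟩ := v.exists_ae_tendsto hp.le
  refine ⟨v.memLp.1, lt_of_le_of_lt (Lp.eLpNorm_le_of_ae_tendsto (u := atTop) (f := φ)
    (C := C * M) (Eventually.of_forall fun n => (hsob _ (hφ n)).trans ?_)
    (fun n => ((hφ n).memLp 1 _).1) hae) (ENNReal.mul_lt_top hC.lt_top hM.lt_top)⟩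
  gcongr
  exact hle n

/-- A bound for the flux integral `∫ w ‖f‖ ^ (p - 2) ⟪f, k⟫`, via `abs_norm_rpow_mul_inner_le`, that
depends only on norms. -/
theorem ofReal_integral_mul_norm_add_norm_rpow_le {α : Type*} [MeasurableSpace α] {μ : Measure α}
    {F : Type*} [NormedAddCommGroup F] (hp : 1 < p) {w : α → ℝ} (hw : MemLp w ⊤ μ)
    {f k : α → F} (hf : MemLp f (ENNReal.ofReal p) μ) (hk : MemLp k (ENNReal.ofReal p) μ) :
    ENNReal.ofReal (∫ x, |w x| * (‖f x‖ + ‖k x‖) ^ p ∂μ) ≤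
      eLpNorm w ⊤ μ * (eLpNorm f (ENNReal.ofReal p) μ + eLpNorm k (ENNReal.ofReal p) μ) ^ p := by
  have hp0 : 0 < p := by linarith
  have hsum : eLpNorm (fun x => ‖f x‖ + ‖k x‖) (ENNReal.ofReal p) μ ≤
      eLpNorm f (ENNReal.ofReal p) μ + eLpNorm k (ENNReal.ofReal p) μ := by
    refine (eLpNorm_add_le hf.norm.1 hk.norm.1 (by simpa using hp.le)).trans (le_of_eq ?_)
    simp only [eLpNorm_norm]
  have hpow := eLpNorm_nnreal_pow_eq_lintegral (μ := μ) (f := fun x => ‖f x‖ + ‖k x‖)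
    (p := p.toNNReal) (by simpa using hp0)
  rw [Real.coe_toNNReal _ hp0.le] at hpow
  rw [ofReal_integral_eq_lintegral_ofReal (integrable_mul_norm_add_norm_rpow hp hw hf hk)
    (Eventually.of_forall fun x => by positivity)]
  calc ∫⁻ x, ENNReal.ofReal (|w x| * (‖f x‖ + ‖k x‖) ^ p) ∂μ
      ≤ ∫⁻ x, eLpNorm w ⊤ μ * ‖(‖f x‖ + ‖k x‖)‖ₑ ^ p ∂μ := by
        refine lintegral_mono_ae ?_
        filter_upwards [ae_le_eLpNormEssSup (f := w) (μ := μ)] with x hx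
        rw [ENNReal.ofReal_mul (abs_nonneg _), ← ENNReal.ofReal_rpow_of_nonneg (by positivity)
          hp0.le, ← Real.enorm_eq_ofReal_abs, ← Real.enorm_eq_ofReal (by positivity),
          eLpNorm_exponent_top]
        gcongr
    _ = eLpNorm w ⊤ μ * eLpNorm (fun x => ‖f x‖ + ‖k x‖) (ENNReal.ofReal p) μ ^ p := by
        rw [lintegral_const_mul' _ _ hw.2.ne, ← hpow]
        rfl
    _ ≤ _ := by gcongr

/-! ### Variations of the energy -/

section Variation

variable {r γ lam : ℝ} {ξ a : E N → ℝ}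

theorem integrable_flux_and_hasDerivAt_gradTerm (hΩ : Bornology.IsBounded Ω) (hp : 1 < p)
    (hξ : MemLp ξ ⊤ (volume.restrict Ω)) (u v : W0 Ω p) :
    IntegrableOn (fun x => ξ x * (‖u.grad x‖ ^ (p - 2) * inner ℝ (u.grad x) (v.grad x))) Ω ∧
    HasDerivAt (fun t => gradTerm ξ (u.add hΩ hp.le (v.smul t)))
      (p * ∫ x in Ω, ξ x * (‖u.grad x‖ ^ (p - 2) * inner ℝ (u.grad x) (v.grad x))) 0 :=
  hasDerivAt_integral_norm_rpow hp hξ u.memLp_grad v.memLp_grad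

theorem integrable_and_hasDerivAt_powerTerm (hΩ : Bornology.IsBounded Ω) (hp : 1 < p)
    (hr : 1 < r) {u v : W0 Ω p} (hu : MemLp u.toFun (ENNReal.ofReal r) (volume.restrict Ω))
    (hv : MemLp v.toFun (ENNReal.ofReal r) (volume.restrict Ω))
    (hu0 : ∀ᵐ x ∂(volume.restrict Ω), 0 ≤ u.toFun x) :
    IntegrableOn (fun x => u.toFun x ^ (r - 1) * v.toFun x) Ω ∧
    HasDerivAt (fun t => powerTerm r (u.add hΩ hp.le (v.smul t)))
      (r * ∫ x in Ω, u.toFun x ^ (r - 1) * v.toFun x) 0 := by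
  have : IsFiniteMeasure (volume.restrict Ω) := ⟨by simpa using hΩ.measure_lt_top⟩
  have h := hasDerivAt_integral_norm_rpow hr (memLp_const (1 : ℝ)) hu hv
  have hae : (fun x => (1 : ℝ) * (‖u.toFun x‖ ^ (r - 2) * inner ℝ (u.toFun x) (v.toFun x)))
      =ᵐ[volume.restrict Ω] fun x => u.toFun x ^ (r - 1) * v.toFun x := by
    filter_upwards [hu0] with x hx
    rcases hx.eq_or_lt with h0 | h0
    · simp [← h0, Real.zero_rpow (by linarith : r - 1 ≠ 0)]
    have e : u.toFun x ^ (r - 1) = u.toFun x ^ (r - 2) * u.toFun x := by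
      rw [← Real.rpow_add_one h0.ne']; ring_nf
    rw [Real.norm_of_nonneg hx, e]
    simp only [RCLike.inner_apply, conj_trivial]
    ring
  refine ⟨h.1.congr hae, ?_⟩
  rw [← integral_congr_ae hae]
  simpa only [one_mul] using! h.2

/-- A minimizer on `N_lam^+` is a local minimizer of the energy along every line through it. -/
theorem eventually_energy_le_energy_add_smul (hΩ : Bornology.IsBounded Ω) (hγ0 : 0 < γ)
    (hγ1 : γ < 1) (hp : 1 < p) (hpr : p < r) (hlam : 0 < lam) {u : W0 Ω p}
    (hu_mem : u ∈ nehariPlus Ω p ξ a γ r lam)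
    (hu_min : IsMinOn (energy ξ a γ r lam) (nehariPlus Ω p ξ a γ r lam) u) (v : W0 Ω p)
    (hA : ContinuousAt (fun t => gradTerm ξ (u.add hΩ hp.le (v.smul t))) 0)
    (hB : ContinuousAt (fun t => singularTerm a γ (u.add hΩ hp.le (v.smul t))) 0)
    (hP : ContinuousAt (fun t => powerTerm r (u.add hΩ hp.le (v.smul t))) 0) :
    ∀ᶠ t in 𝓝 (0 : ℝ), energy ξ a γ r lam u ≤ energy ξ a γ r lam (u.add hΩ hp.le (v.smul t)) := by
  obtain ⟨⟨heq, -⟩, hpos⟩ := hu_mem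
  have hA0 : gradTerm ξ (u.add hΩ hp.le (v.smul 0)) = gradTerm ξ u := by
    simp [gradTerm, W0.add, W0.smul]
  have hB0 : singularTerm a γ (u.add hΩ hp.le (v.smul 0)) = singularTerm a γ u := by
    simp [singularTerm, W0.add, W0.smul]
  have hP0 : powerTerm r (u.add hΩ hp.le (v.smul 0)) = powerTerm r u := by
    simp [powerTerm, W0.add, W0.smul]
  have hPnonneg : 0 ≤ powerTerm r u := integral_nonneg fun x => by positivity
  have hBpos : 0 < singularTerm a γ u := by
    have h1 : 0 ≤ lam * powerTerm r u := mul_nonneg hlam.le hPnonneg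
    nlinarith
  have hBev : ∀ᶠ t in 𝓝 (0 : ℝ), 0 < singularTerm a γ (u.add hΩ hp.le (v.smul t)) :=
    hB.eventually (lt_mem_nhds (by simpa only [hB0] using hBpos))
  have hfib := eventually_exists_fiber_scaling (lam := lam) hγ1 (by linarith : p ≠ 0)
    (by linarith : r ≠ 0) hA hB hP (by simpa only [hA0, hB0, hP0] using heq)
    (by simpa only [hA0, hP0] using hpos)
  filter_upwards [hfib, hBev] with t ⟨s, hs, h1, h2, h3⟩ hBt
  set w := u.add hΩ hp.le (v.smul t)
  have hAs : gradTerm ξ (w.smul s) = s ^ p * gradTerm ξ w := by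
    simp only [gradTerm, W0.smul, norm_smul, Real.norm_of_nonneg hs.le]
    rw [← integral_const_mul]
    congr 1
    ext x
    rw [Real.mul_rpow hs.le (norm_nonneg _)]
    ring
  have hBs : singularTerm a γ (w.smul s) = s ^ (1 - γ) * singularTerm a γ w := by
    simp only [singularTerm, W0.smul, abs_mul, abs_of_pos hs]
    rw [← integral_const_mul]
    congr 1
    ext x
    rw [Real.mul_rpow hs.le (abs_nonneg _)]
    ring
  have hPs : powerTerm r (w.smul s) = s ^ r * powerTerm r w := by
    simp only [powerTerm, W0.smul, abs_mul, abs_of_pos hs]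
    rw [← integral_const_mul]
    congr 1
    ext x
    rw [Real.mul_rpow hs.le (abs_nonneg _)]
  have hmem : w.smul s ∈ nehariPlus Ω p ξ a γ r lam := by
    refine ⟨⟨?_, fun h0 => ?_⟩, ?_⟩
    · rw [hAs, hBs, hPs]; exact h1
    -- A positive singular term rules out that `s w` vanishes almost everywhere.
    · have : singularTerm a γ (w.smul s) = 0 := by
        refine integral_eq_zero_of_ae ?_
        filter_upwards [h0] with x hx
        simp [hx, Real.zero_rpow (by linarith : 1 - γ ≠ 0)]
      rw [hBs] at this
      exact (mul_pos (Real.rpow_pos_of_pos hs _) hBt).ne' this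
    · rw [hAs, hPs]; exact h2
  refine (hu_min hmem).trans ?_
  simp only [energy, hAs, hBs, hPs]
  exact h3

end Variation

end SingularPLaplace

end

theorem proposition7 (N : ℕ) (hN : 1 ≤ N)
    (Ω : Set (SingularPLaplace.E N)) (hΩ_open : IsOpen Ω) (hΩ_bdd : Bornology.IsBounded Ω)
    (p r γ : ℝ) (hγ0 : 0 < γ) (hγ1 : γ < 1) (hp : 1 < p) (hpr : p < r)
    (hr : ENNReal.ofReal r < SingularPLaplace.criticalExponent N p)
    (ξ a : SingularPLaplace.E N → ℝ)
    (hξ : MemLp ξ ⊤ (volume.restrict Ω)) (ha : MemLp a ⊤ (volume.restrict Ω))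
    (ξ₀ : ℝ) (hξ₀ : 0 < ξ₀) (hξ_lower : ∀ᵐ x ∂(volume.restrict Ω), ξ₀ ≤ ξ x)
    (ha_pos : ∀ᵐ x ∂(volume.restrict Ω), 0 < a x)
    (lam : ℝ) (hlam : 0 < lam)
    (u : SingularPLaplace.W0 Ω p)
    (hu_mem : u ∈ SingularPLaplace.nehariPlus Ω p ξ a γ r lam)
    (hu_min : IsMinOn (SingularPLaplace.energy ξ a γ r lam)
      (SingularPLaplace.nehariPlus Ω p ξ a γ r lam) u)
    (hu_nonneg : ∀ᵐ x ∂(volume.restrict Ω), 0 ≤ u.toFun x) :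
    SingularPLaplace.IsWeakSolution ξ a γ r lam u := by
  open SingularPLaplace in
  have hfin : IsFiniteMeasure (volume.restrict Ω) := ⟨by simpa using hΩ_bdd.measure_lt_top⟩
  have hq0 : 0 < 1 - γ := by linarith
  have hq1 : 1 - γ < 1 := by linarith
  have hr0 : 0 < r := by linarith
  have hLr := fun v : W0 Ω p => v.memLp_of_lt_criticalExponent hN hΩ_bdd hp hpr hr
  have hL1 := fun v : W0 Ω p => v.integrable hΩ_bdd hp.le
  have hA := fun v : W0 Ω p => integrable_flux_and_hasDerivAt_gradTerm hΩ_bdd hp hξ u v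
  have hP := fun v : W0 Ω p => integrable_and_hasDerivAt_powerTerm hΩ_bdd hp
    (hp.trans hpr) (hLr u) (hLr v) hu_nonneg
  set flux : W0 Ω p → ℝ := fun v =>
    ∫ x in Ω, ξ x * (‖u.grad x‖ ^ (p - 2) * inner ℝ (u.grad x) (v.grad x)) with hflux
  set power : W0 Ω p → ℝ := fun v => ∫ x in Ω, u.toFun x ^ (r - 1) * v.toFun x with hpower
  set S : W0 Ω p → ℝ → ℝ := fun v t => 1 / p * gradTerm ξ (u.add hΩ_bdd hp.le (v.smul t)) -
    lam / r * powerTerm r (u.add hΩ_bdd hp.le (v.smul t)) with hSdef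
  have hS : ∀ v, HasDerivAt (S v) (flux v - lam * power v) 0 := fun v => by
    refine (((hA v).2.const_mul (1 / p)).sub ((hP v).2.const_mul (lam / r))).congr_deriv ?_
    have hp0 : p ≠ 0 := by linarith
    simp only [hflux, hpower]
    field_simp
  have hmin : ∀ v : W0 Ω p, ∀ᶠ t in 𝓝 (0 : ℝ),
      energy ξ a γ r lam u ≤ energy ξ a γ r lam (u.add hΩ_bdd hp.le (v.smul t)) := fun v =>
    eventually_energy_le_energy_add_smul hΩ_bdd hγ0 hγ1 hp hpr hlam hu_mem hu_min v
      (hA v).2.continuousAt (continuousAt_integral_abs_rpow hq0 hq1.le ha (hL1 u) (hL1 v))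
      (hP v).2.continuousAt
  have hzero : ∀ v : W0 Ω p, energy ξ a γ r lam (u.add hΩ_bdd hp.le (v.smul 0)) =
      energy ξ a γ r lam u := fun v => by
    simp [energy, gradTerm, singularTerm, powerTerm, W0.add, W0.smul]
  -- `S v` collects the two terms of the energy already known to be differentiable along `v`; on the
  -- singular term only one-sided information is available so far.
  have hone_sided : ∀ ψ (hψ : IsTestFunction Ω ψ), (∀ x, 0 ≤ ψ x) →
      (∀ᵐ x ∂(volume.restrict Ω), 0 < ψ x → 0 < u.toFun x) ∧
      ∫⁻ x in Ω, ENNReal.ofReal (a x * u.toFun x ^ (1 - γ - 1) * ψ x) ≤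
        ENNReal.ofReal (flux (hψ.toW0 p) - lam * power (hψ.toW0 p)) := by
    intro ψ hψ hψ0
    refine ae_pos_and_lintegral_le_of_hasDerivAt hq0 hq1 ha_pos hu_nonneg
      (Eventually.of_forall hψ0) (fun t => integrable_mul_abs_rpow hq0 hq1.le ha
        ((hL1 u).add ((hL1 (hψ.toW0 p)).const_mul t))) (hS (hψ.toW0 p)) ?_
    filter_upwards [hmin (hψ.toW0 p)] with t ht
    rw [← hzero (hψ.toW0 p)] at ht
    have e0 : ∫ x in Ω, a x * |u.toFun x| ^ (1 - γ) =
        singularTerm a γ (u.add hΩ_bdd hp.le ((hψ.toW0 p).smul 0)) := by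
      simp [singularTerm, W0.add, W0.smul]
    have e1 : ∫ x in Ω, a x * |u.toFun x + t * ψ x| ^ (1 - γ) =
        singularTerm a γ (u.add hΩ_bdd hp.le ((hψ.toW0 p).smul t)) := rfl
    rw [e0, e1]
    simp only [energy] at ht
    simp only [hSdef]
    linarith
  -- Bump functions show that `u` is positive almost everywhere near each point of `Ω`.
  have hpos : ∀ᵐ x ∂(volume.restrict Ω), 0 < u.toFun x := by
    rw [ae_restrict_iff' hΩ_open.measurableSet, ae_iff]
    refine measure_null_of_locally_null _ fun x hx => ?_
    obtain ⟨hxΩ, -⟩ := Classical.not_imp.1 hx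
    obtain ⟨ψ, hψΩ, hψc, hψs, hψr, hψx⟩ :=
      exists_contDiff_tsupport_subset (n := ⊤) (hΩ_open.mem_nhds hxΩ)
    have h1 := (hone_sided ψ ⟨hψs, hψc, hψΩ⟩ fun y => (hψr ⟨y, rfl⟩).1).1
    rw [ae_restrict_iff' hΩ_open.measurableSet, ae_iff] at h1
    have hU : {y | 0 < ψ y} ∈ 𝓝 x :=
      hψs.continuous.continuousAt.eventually (lt_mem_nhds (by rw [hψx]; exact one_pos))
    refine ⟨_, inter_mem_nhdsWithin _ hU, measure_mono_null ?_ h1⟩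
    rintro y ⟨hy, hψy⟩
    simp only [Set.mem_ofPred_eq, Classical.not_imp] at hy ⊢
    exact ⟨hy.1, hψy, hy.2⟩
  have hsing : ∀ h : W0 Ω p,
      IntegrableOn (fun x => a x * u.toFun x ^ (1 - γ - 1) * h.toFun x) Ω := by
    intro h
    obtain ⟨φ, hφ, hae, M, hM, hle⟩ := h.exists_ae_tendsto hp.le
    set ε : ℕ → ℝ := fun n => 1 / ((n : ℝ) + 1) with hε
    have hε0 : ∀ n, 0 < ε n := fun n => by simp only [hε]; positivity
    set K : ENNReal := eLpNorm ξ ⊤ (volume.restrict Ω) *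
      (eLpNorm u.grad (ENNReal.ofReal p) (volume.restrict Ω) + M) ^ p with hK
    have hKtop : K ≠ ⊤ := ENNReal.mul_ne_top hξ.2.ne
      (ENNReal.rpow_ne_top_of_nonneg (by linarith)
        (ENNReal.add_ne_top.2 ⟨u.memLp_grad.2.ne, hM⟩))
    -- The nonnegative test functions `ψ n` converge to `|h|`, and their gradients are bounded by
    -- those of `φ n`.
    set ψ : ℕ → E N → ℝ := fun n x => √(φ n x ^ 2 + ε n ^ 2) - ε n with hψdef
    have hψ : ∀ n, IsTestFunction Ω (ψ n) := fun n => (hφ n).sqrt_sq_add_sq_sub (hε0 n)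
    have hψ0 : ∀ n x, 0 ≤ ψ n x := fun n x => sqrt_sq_add_sq_sub_nonneg _ _
    have hbound : ∀ n,
        ∫⁻ x in Ω, ENNReal.ofReal (a x * u.toFun x ^ (1 - γ - 1) * ψ n x) ≤ K := by
      intro n
      refine (hone_sided _ (hψ n) (hψ0 n)).2.trans ?_
      have hpw : 0 ≤ power ((hψ n).toW0 p) := by
        refine integral_nonneg_of_ae ?_
        filter_upwards [hu_nonneg] with x hx
        exact mul_nonneg (Real.rpow_nonneg hx _) (hψ0 n x)
      have hfl : flux ((hψ n).toW0 p) ≤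
          ∫ x in Ω, |ξ x| * (‖u.grad x‖ + ‖gradient (ψ n) x‖) ^ p := by
        refine integral_mono (hA _).1 (integrable_mul_norm_add_norm_rpow hp hξ u.memLp_grad
          ((hψ n).memLp_gradient _ _)) fun x => (le_abs_self _).trans ?_
        simp only
        rw [abs_mul]
        gcongr
        exact abs_norm_rpow_mul_inner_le hp (by simp) (by simp [IsTestFunction.toW0])
      refine (ENNReal.ofReal_le_ofReal (by nlinarith [mul_nonneg hlam.le hpw])).trans
        ((ofReal_integral_mul_norm_add_norm_rpow_le hp hξ u.memLp_grad
          ((hψ n).memLp_gradient _ _)).trans ?_)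
      rw [hK]
      gcongr
      exact (eLpNorm_mono fun x =>
        (hφ n).norm_gradient_sqrt_sq_add_sq_sub_le (hε0 n) x).trans (hle n)
    have hψlim : ∀ᵐ x ∂(volume.restrict Ω),
        Tendsto (fun n => ψ n x) atTop (𝓝 |h.toFun x|) := by
      filter_upwards [hae] with x hx
      have h1 : Tendsto (fun n => ψ n x - |φ n x|) atTop (𝓝 0) :=
        squeeze_zero_norm (fun n => abs_sqrt_sq_add_sq_sub_sub_abs_le (hε0 n) _)
          tendsto_one_div_add_atTop_nhds_zero_nat
      simpa using h1.add hx.abs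
    have hmeas : AEStronglyMeasurable (fun x => a x * u.toFun x ^ (1 - γ - 1))
        (volume.restrict Ω) :=
      ha.1.mul (u.memLp.1.aemeasurable.pow_const _).aestronglyMeasurable
    have hfatou : ∫⁻ x in Ω, ENNReal.ofReal (a x * u.toFun x ^ (1 - γ - 1) * |h.toFun x|) ≤
        K := by
      have h1 := lintegral_liminf_le' (μ := volume.restrict Ω) (u := atTop)
        (f := fun n x => ENNReal.ofReal (a x * u.toFun x ^ (1 - γ - 1) * ψ n x))
        fun n => (hmeas.mul ((hψ n).memLp 1 _).1).aemeasurable.ennreal_ofReal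
      refine le_trans (lintegral_mono_ae ?_) (h1.trans
        ((liminf_le_liminf (Eventually.of_forall hbound)).trans_eq (liminf_const _)))
      filter_upwards [hψlim] with x hx
      exact ((ENNReal.continuous_ofReal.tendsto _).comp (hx.const_mul _)).liminf_eq.ge
    refine ⟨hmeas.mul h.memLp.1, ?_⟩
    rw [hasFiniteIntegral_iff_norm]
    refine lt_of_le_of_lt (le_of_eq (lintegral_congr_ae ?_)) (hfatou.trans_lt hKtop.lt_top)
    filter_upwards [ha_pos, hu_nonneg] with x hx hux
    rw [norm_mul, Real.norm_of_nonneg (mul_nonneg hx.le (Real.rpow_nonneg hux _)),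
      Real.norm_eq_abs]
  have hexp : 1 - γ - 1 = -γ := by ring
  refine ⟨hpos, fun h => (hA h).1, fun h => by simpa only [hexp] using hsing h,
    fun h => (hP h).1, fun h => ?_⟩
  have hB := hasDerivAt_integral_abs_rpow hq0 hq1.le ha (hL1 u) (hL1 h) hpos (hsing h)
  have hE : HasDerivAt (fun t => energy ξ a γ r lam (u.add hΩ_bdd hp.le (h.smul t)))
      (flux h - lam * power h - ∫ x in Ω, a x * u.toFun x ^ (1 - γ - 1) * h.toFun x) 0 := by
    have h1 := (hS h).sub (hB.const_mul (1 / (1 - γ)))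
    refine (h1.congr_deriv ?_).congr_of_eventuallyEq (Eventually.of_forall fun t => ?_)
    · field_simp
    · simp only [energy, hSdef, Pi.sub_apply, singularTerm, W0.add, W0.smul]
      ring
  have hloc : IsLocalMin (fun t => energy ξ a γ r lam (u.add hΩ_bdd hp.le (h.smul t))) 0 := by
    filter_upwards [hmin h] with t ht
    rw [hzero h]
    exact ht
  have := hloc.hasDerivAt_eq_zero hE
  rw [hexp] at this
  simp only [hflux, hpower] at this
  linarith
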